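/- Let $G$ be a finite group which is nilpotent of class at most $2$ or has odd order. Then the following statements are equivalent: (i) $G$ is inverse semi-rational: for every $x\in G$, every generator of the cyclic group $\langle x\rangle$ is conjugate in $G$ to $x$ or to $x^{-1}$. (ii) $G$ is uniformly semi-rational: there is an integer $m$ such that for every $x\in G$, every generator of $\langle x\rangle$ is conjugate in $G$ to $x$ or to $x^{m}$. (iii) $G$ is quadratic semi-rational: $G$ satisfies both (iv) and (v). (iv) $G$ is quadratic rational: for every irreducible complex character $\chi$ of $G$, the field $\mathbb{Q}(\chi)=\mathbb{Q}(\chi(x) : x\in G)$ is either $\mathbb{Q}$ or a quadratic extension of $\mathbb{Q}$. (v) $G$ is semi-rational: for every $x\in G$, the generators of $\langle x\rangle$ are contained in a union of at most two conjugacy classes of $G$. -/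

import Mathlib

universe u

/-- The generators of the cyclic subgroup `⟨x⟩`. -/
def cyclicGenerators {G : Type u} [Group G] (x : G) : Set G :=
  {y | Subgroup.zpowers y = Subgroup.zpowers x}

/-- `x` is semi-rational: the generators of `⟨x⟩` lie in a union of at most two conjugacy classes. -/
def IsSemiRationalElement {G : Type u} [Group G] (x : G) : Prop :=
  ∃ C D : ConjClasses G, cyclicGenerators x ⊆ C.carrier ∪ D.carrier

/-- `x` is inverse semi-rational: every generator of `⟨x⟩` is conjugate to `x` or to `x⁻¹`. -/
def IsInverseSemiRationalElement {G : Type u} [Group G] (x : G) : Prop :=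
  cyclicGenerators x ⊆ conjugatesOf x ∪ conjugatesOf x⁻¹

def IsSemiRationalGroup (G : Type u) [Group G] : Prop :=
  ∀ x : G, IsSemiRationalElement x

def IsInverseSemiRationalGroup (G : Type u) [Group G] : Prop :=
  ∀ x : G, IsInverseSemiRationalElement x

/-- One integer `m` works for all elements `x` of the group: every generator of `⟨x⟩` is conjugate
to `x` or to `x ^ m`. -/
def IsUniformlySemiRationalGroup (G : Type u) [Group G] : Prop :=
  ∃ m : ℤ, ∀ x : G, cyclicGenerators x ⊆ conjugatesOf x ∪ conjugatesOf (x ^ m)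

/-- `Irr(G)`: the characters of the irreducible finite-dimensional complex representations. -/
def irreducibleCharacters (G : Type u) [Group G] : Set (G → ℂ) :=
  {χ | ∃ (V : Type u) (_ : AddCommGroup V) (_ : Module ℂ V) (_ : FiniteDimensional ℂ V)
      (ρ : Representation ℂ G V), ρ.IsIrreducible ∧ χ = ρ.character}

/-- The character field `ℚ(χ) = ℚ(χ(x) : x ∈ G)`. -/
noncomputable def characterField {G : Type u} (χ : G → ℂ) : IntermediateField ℚ ℂ :=
  IntermediateField.adjoin ℚ (Set.range χ)

/-- Every irreducible character has character field `ℚ` or a quadratic extension of `ℚ`. -/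
def IsQuadraticRationalGroup (G : Type u) [Group G] : Prop :=
  ∀ χ ∈ irreducibleCharacters G,
    characterField χ = ⊥ ∨ Module.finrank ℚ (characterField χ) = 2

def IsQuadraticSemiRationalGroup (G : Type u) [Group G] : Prop :=
  IsSemiRationalGroup G ∧ IsQuadraticRationalGroup G

/-! ### Generators of cyclic subgroups, and elements conjugate to their inverses. -/

section GroupTheory

open scoped commutatorElement

variable {G : Type u} [Group G]

/-! Call (i) ISR. The hypothesis on `G` enters only twice: if `x` is conjugate to `x⁻¹` then `x ^ 4
= 1`, and real irreducible characters are rational. The first turns semi-rational into ISR: either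
the two classes are those of `x` and `x⁻¹`, or the only generators of `⟨x⟩` are `x` and `x⁻¹`.

ISR gives quadratic rational in every finite group. Each `χ g + χ g⁻¹` is rational, so an embedding
of `ℚ(χ)` in `ℂ` preserves both these sums and the product formula for `χ`. By
`eq_or_eq_comp_inv_of_product_formula` it sends `χ` to `χ` or to `χ` composed with inversion, so
there are at most two embeddings.

Conversely, if `y` generates `⟨x⟩`, then `χ y` is algebraically conjugate to `χ x`. For non-real `χ`
the field is imaginary quadratic, so `χ y` is `χ x` or its complex conjugate; for real `χ` the
values are rational and equal. Hence `χ y + χ y⁻¹ = χ x + χ x⁻¹` for all irreducible `χ`, and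
characters separate classes up to inversion. -/

theorem exists_coprime_pow_of_mem_cyclicGenerators [Finite G] {x y : G}
    (hy : y ∈ cyclicGenerators x) : ∃ r : ℕ, r.Coprime (orderOf x) ∧ x ^ r = y := by
  have hy' : Subgroup.zpowers y = Subgroup.zpowers x := hy
  have hmem : y ∈ Subgroup.zpowers x := hy' ▸ Subgroup.mem_zpowers y
  obtain ⟨r, rfl⟩ := mem_powers_iff_mem_zpowers.mpr hmem
  refine ⟨r, ?_, rfl⟩
  have h : orderOf (x ^ r) = orderOf x := by
    rw [← Nat.card_zpowers, ← Nat.card_zpowers]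
    exact congrArg (fun H : Subgroup G => Nat.card H) hy'
  rw [orderOf_pow, Nat.div_eq_self] at h
  have := (orderOf_pos x).ne'
  rw [Nat.coprime_comm]
  tauto

theorem pow_mem_cyclicGenerators [Finite G] (x : G) {r : ℕ} (hr : r.Coprime (orderOf x)) :
    x ^ r ∈ cyclicGenerators x := by
  refine Subgroup.eq_of_le_of_card_ge
    (Subgroup.zpowers_le.mpr (Subgroup.npow_mem_zpowers x r)) ?_
  rw [Nat.card_zpowers, Nat.card_zpowers, orderOf_pow, Nat.coprime_comm.mp hr, Nat.div_one]

theorem inv_mem_cyclicGenerators (x : G) : x⁻¹ ∈ cyclicGenerators x :=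
  Subgroup.zpowers_inv

theorem self_mem_cyclicGenerators (x : G) : x ∈ cyclicGenerators x := rfl

theorem eq_or_eq_inv_of_mem_cyclicGenerators_of_pow_four [Finite G] {x y : G} (hx : x ^ 4 = 1)
    (hy : y ∈ cyclicGenerators x) : y = x ∨ y = x⁻¹ := by
  have hdvd := orderOf_dvd_of_pow_eq_one hx
  obtain ⟨r, hr, rfl⟩ := exists_coprime_pow_of_mem_cyclicGenerators hy
  have hle := Nat.le_of_dvd (by norm_num) hdvd
  rcases (by revert hdvd; interval_cases orderOf x <;> simp :
    orderOf x = 0 ∨ orderOf x = 1 ∨ orderOf x = 2 ∨ orderOf x = 4) with h | h | h | h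
  · exact absurd h (orderOf_pos x).ne'
  · rw [orderOf_eq_one_iff] at h
    simp [h]
  · left
    rw [h, Nat.coprime_two_right] at hr
    obtain ⟨k, rfl⟩ := hr
    rw [pow_succ, pow_mul, ← h, pow_orderOf_eq_one, one_pow, one_mul]
  · rw [h, show 4 = 2 ^ 2 by norm_num, Nat.coprime_pow_right_iff (by norm_num),
      Nat.coprime_two_right] at hr
    have hr4 : r % 4 = 1 ∨ r % 4 = 3 := by
      rcases hr with ⟨k, rfl⟩; omega
    rw [← Nat.div_add_mod r 4, pow_add, pow_mul, hx, one_pow, one_mul]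
    rcases hr4 with h4 | h4
    · simp [h4]
    · right
      rw [h4, eq_inv_iff_mul_eq_one, ← pow_succ, hx]

/-- If `g` inverts `x`, then `⁅g, x⁆ = x⁻²` is both centralized and inverted by `g`. -/
theorem pow_four_eq_one_of_isConj_inv_of_commutator_central
    (hG : ∀ a b c : G, Commute ⁅a, b⁆ c) {x : G} (hx : IsConj x x⁻¹) : x ^ 4 = 1 := by
  obtain ⟨g, hg⟩ := isConj_iff.mp hx
  have h2 : Commute (x⁻¹ * x⁻¹) g := by
    have := hG g x g
    rwa [commutatorElement_def, hg] at this
  have h3 : x⁻¹ * x⁻¹ = x * x := by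
    have h4 : g * (x⁻¹ * x⁻¹) * g⁻¹ = x * x := by
      have : g * x⁻¹ * g⁻¹ = x := by rw [← conj_inv, hg, inv_inv]
      calc g * (x⁻¹ * x⁻¹) * g⁻¹ = (g * x⁻¹ * g⁻¹) * (g * x⁻¹ * g⁻¹) := by group
        _ = x * x := by rw [this]
    rwa [← h2.eq, mul_inv_cancel_right] at h4
  calc x ^ 4 = (x * x) * (x * x) := by simp only [pow_succ, pow_zero, one_mul, mul_assoc]
    _ = 1 := by rw [← h3]; nth_rewrite 2 [h3]; group

/-- If `g` inverts `x`, then `g ^ 2` centralizes `x`; in odd order `g` is a power of `g ^ 2`, so `x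
= x⁻¹`. -/
theorem eq_one_of_isConj_inv_of_odd_card [Finite G] (hG : Odd (Nat.card G)) {x : G}
    (hx : IsConj x x⁻¹) : x = 1 := by
  obtain ⟨g, hg⟩ := isConj_iff.mp hx
  have hcop : ∀ a : G, (2 : ℕ).Coprime (orderOf a) := fun a =>
    Nat.coprime_two_left.mpr (hG.of_dvd_nat (orderOf_dvd_natCard a))
  have h2 : Commute (g ^ 2) x := by
    have : g ^ 2 * x * (g ^ 2)⁻¹ = x := by
      calc g ^ 2 * x * (g ^ 2)⁻¹ = g * (g * x * g⁻¹) * g⁻¹ := by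
            simp only [pow_two, mul_inv_rev, mul_assoc]
        _ = x := by rw [hg, ← conj_inv, hg, inv_inv]
    exact mul_inv_eq_iff_eq_mul.mp this
  obtain ⟨m, hm⟩ := exists_pow_eq_self_of_coprime (hcop g)
  have h1 : Commute g x := hm ▸ h2.pow_left m
  rw [h1.eq, mul_inv_cancel_right] at hg
  have hx2 : x ^ 2 = 1 := by
    rw [pow_two]; nth_rewrite 2 [hg]; exact mul_inv_cancel x
  obtain ⟨k, hk⟩ := exists_pow_eq_self_of_coprime (hcop x)
  rw [← hk, hx2, one_pow]

theorem commute_commutator_of_nilpotencyClass_le_two [Group.IsNilpotent G]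
    (h : Group.nilpotencyClass G ≤ 2) (a b c : G) : Commute ⁅a, b⁆ c := by
  have h2 := Subgroup.lowerCentralSeries_eq_bot_iff_nilpotencyClass_le.mpr h
  have hab : ⁅a, b⁆ ∈ (⊤ : Subgroup G).lowerCentralSeries 1 :=
    Subgroup.commutator_mem_commutator (Subgroup.mem_top a) (Subgroup.mem_top b)
  have habc : ⁅⁅a, b⁆, c⁆ ∈ (⊤ : Subgroup G).lowerCentralSeries 2 :=
    Subgroup.commutator_mem_commutator hab (Subgroup.mem_top c)
  rw [h2, Subgroup.mem_bot] at habc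
  exact commutatorElement_eq_one_iff_commute.mp habc

theorem IsSemiRationalGroup.isInverseSemiRationalGroup [Finite G] (h : IsSemiRationalGroup G)
    (hG : ∀ x : G, IsConj x x⁻¹ → x ^ 4 = 1) : IsInverseSemiRationalGroup G := by
  intro x y hy
  by_cases hx : IsConj x x⁻¹
  · rcases eq_or_eq_inv_of_mem_cyclicGenerators_of_pow_four (hG x hx) hy with rfl | rfl
    · exact Or.inl (mem_conjugatesOf_self)
    · exact Or.inr (mem_conjugatesOf_self)
  · obtain ⟨C, D, hCD⟩ := h x
    have key := hCD hy
    have h1 := hCD (self_mem_cyclicGenerators x)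
    have h2 := hCD (inv_mem_cyclicGenerators x)
    simp only [Set.mem_union, ConjClasses.mem_carrier_iff_mk_eq] at key h1 h2
    rw [← ConjClasses.mk_eq_mk_iff_isConj] at hx
    change IsConj x y ∨ IsConj x⁻¹ y
    simp only [← ConjClasses.mk_eq_mk_iff_isConj]
    grind

theorem IsInverseSemiRationalGroup.isUniformlySemiRationalGroup
    (h : IsInverseSemiRationalGroup G) : IsUniformlySemiRationalGroup G :=
  ⟨-1, fun x => by rw [zpow_neg_one]; exact h x⟩

theorem IsUniformlySemiRationalGroup.isSemiRationalGroup
    (h : IsUniformlySemiRationalGroup G) : IsSemiRationalGroup G := by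
  obtain ⟨m, hm⟩ := h
  exact fun x => ⟨ConjClasses.mk x, ConjClasses.mk (x ^ m), fun y hy => by
    rcases hm x hy with h | h
    · exact Or.inl (ConjClasses.mem_carrier_iff_mk_eq.mpr
        (ConjClasses.mk_eq_mk_iff_isConj.mpr (IsConj.symm h)))
    · exact Or.inr (ConjClasses.mem_carrier_iff_mk_eq.mpr
        (ConjClasses.mk_eq_mk_iff_isConj.mpr (IsConj.symm h)))⟩

end GroupTheory

/-! ### Integer polynomials evaluated at roots of unity. -/

section Cyclotomic

open Polynomial Module

/-- The traces of the powers of an endomorphism of order dividing `n` are the values of one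
integer polynomial at the powers of a primitive `n`-th root of unity. -/
theorem exists_polynomial_trace_pow {V : Type*} [AddCommGroup V] [Module ℂ V]
    [FiniteDimensional ℂ V] {n : ℕ} [NeZero n] {ζ : ℂ} (hζ : IsPrimitiveRoot ζ n)
    {A : Module.End ℂ V} (hA : A ^ n = 1) :
    ∃ f : ℤ[X], ∀ k : ℕ, LinearMap.trace ℂ V (A ^ k) = aeval (ζ ^ k) f := by
  classical
  have hn : (n : ℂ) ≠ 0 := Nat.cast_ne_zero.mpr (NeZero.ne n)
  have hss : A.IsSemisimple :=
    Module.End.isSemisimple_of_squarefree_aeval_eq_zero (p := X ^ n - 1)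
      ((X_pow_sub_one_separable_iff.mpr hn).squarefree) (by simp [hA])
  have htop : ⨆ μ, A.eigenspace μ = ⊤ := by
    rw [← A.iSup_maxGenEigenspace_eq_top]
    exact iSup_congr fun μ => (hss.isFinitelySemisimple.maxGenEigenspace_eq_eigenspace μ).symm
  have hint := DirectSum.isInternal_submodule_of_iSupIndep_of_iSup_eq_top
    A.eigenspaces_iSupIndep htop
  have hfin : {μ | A.eigenspace μ ≠ ⊥}.Finite :=
    WellFoundedGT.finite_ne_bot_of_iSupIndep A.eigenspaces_iSupIndep
  have hpow : ∀ (μ : ℂ) (v : V), v ∈ A.eigenspace μ → ∀ k : ℕ, (A ^ k) v = μ ^ k • v := by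
    intro μ v hv k
    rw [Module.End.mem_eigenspace_iff] at hv
    induction k with
    | zero => simp
    | succ k ih => rw [pow_succ, Module.End.mul_apply, hv, map_smul, ih, smul_smul, pow_succ']
  have hroot : ∀ μ ∈ hfin.toFinset, ∃ e : ℕ, ζ ^ e = μ := by
    intro μ hμ
    obtain ⟨v, hv, hv0⟩ := (Submodule.ne_bot_iff _).mp (hfin.mem_toFinset.mp hμ)
    have h1 := hpow μ v hv n
    rw [hA, Module.End.one_apply, eq_comm] at h1
    have h2 : μ ^ n = 1 := by
      by_contra hne
      have h3 : (μ ^ n - 1) • v = 0 := by rw [sub_smul, h1, one_smul, sub_self]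
      exact (smul_eq_zero.mp h3).elim (fun h => hne (sub_eq_zero.mp h)) hv0
    obtain ⟨e, -, he⟩ := hζ.eq_pow_of_pow_eq_one h2
    exact ⟨e, he⟩
  choose! e he using hroot
  -- The exponents are those of the eigenvalues `ζ ^ e μ`, the coefficients their multiplicities.
  refine ⟨∑ μ ∈ hfin.toFinset, (finrank ℂ (A.eigenspace μ) : ℤ[X]) * X ^ (e μ), fun k => ?_⟩
  have hmaps : ∀ μ, Set.MapsTo (A ^ k) (A.eigenspace μ) (A.eigenspace μ) := fun μ v hv => by
    rw [SetLike.mem_coe] at hv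
    rw [hpow μ v hv k]
    exact Submodule.smul_mem _ _ hv
  rw [LinearMap.trace_eq_sum_trace_restrict' hint hfin hmaps, map_sum]
  refine Finset.sum_congr rfl fun μ hμ => ?_
  have hres : (A ^ k).restrict (hmaps μ) = μ ^ k • (1 : Module.End ℂ (A.eigenspace μ)) := by
    ext v
    exact hpow μ v v.2 k
  rw [hres, map_smul, LinearMap.trace_one]
  simp only [smul_eq_mul, map_mul, map_natCast, map_pow, aeval_X]
  rw [← pow_mul, mul_comm k, pow_mul, he μ hμ, mul_comm]

theorem isIntegral_aeval {A : Type*} [CommRing A] {z : A} (hz : IsIntegral ℤ z) (f : ℤ[X]) :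
    IsIntegral ℤ (aeval z f) :=
  adjoin_le_integralClosure hz (aeval_mem_adjoin_singleton ℤ z)

/-- Values of a polynomial at primitive roots of unity of the same order are conjugate. -/
theorem isConjRoot_aeval_pow_of_coprime {n : ℕ} [NeZero n] {ζ : ℂ} (hζ : IsPrimitiveRoot ζ n)
    (f : ℤ[X]) {r : ℕ} (hr : r.Coprime n) : IsConjRoot ℚ (aeval ζ f) (aeval (ζ ^ r) f) := by
  have hζi : IsIntegral ℤ ζ := hζ.isIntegral (NeZero.pos n)
  have hf : ∀ z : ℂ, aeval z f = aeval z (f.map (Int.castRingHom ℚ)) := fun z => by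
    rw [← algebraMap_int_eq, aeval_map_algebraMap]
  have hmin : minpoly ℚ ζ = minpoly ℚ (ζ ^ r) := by
    rw [minpoly.isIntegrallyClosed_eq_field_fractions' ℚ hζi,
      minpoly.isIntegrallyClosed_eq_field_fractions' ℚ (hζi.pow r),
      hζ.minpoly_eq_pow_coprime hr]
  have hint : IsIntegral ℚ (aeval ζ f) := (isIntegral_aeval hζi f).tower_top
  refine isConjRoot_of_aeval_eq_zero hint ?_
  have h0 : aeval ζ ((minpoly ℚ (aeval ζ f)).comp (f.map (Int.castRingHom ℚ))) = 0 := by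
    rw [aeval_comp, ← hf, minpoly.aeval]
  -- `ζ` and `ζ ^ r` share a minimal polynomial, so the relation at `ζ` transfers to `ζ ^ r`.
  have h1 := minpoly.dvd ℚ ζ h0
  rw [hmin] at h1
  rw [hf (ζ ^ r), ← aeval_comp]
  exact aeval_eq_zero_of_dvd_aeval_eq_zero h1 (minpoly.aeval ℚ _)

/-- A polynomial that takes the same value at all primitive `n`-th roots of unity has a rational
value there. -/
theorem aeval_mem_range_algebraMap_of_forall_coprime {n : ℕ} [NeZero n] {ζ : ℂ}
    (hζ : IsPrimitiveRoot ζ n) (f : ℤ[X])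
    (h : ∀ r : ℕ, r.Coprime n → aeval (ζ ^ r) f = aeval ζ f) :
    aeval ζ f ∈ (algebraMap ℚ ℂ).range := by
  set Φ : ℚ[X] := cyclotomic n ℚ with hΦ
  have hmonic : Φ.Monic := cyclotomic.monic n ℚ
  set p : ℚ[X] := f.map (Int.castRingHom ℚ) %ₘ Φ with hp
  have hval : ∀ r : ℕ, r.Coprime n → aeval (ζ ^ r) p = aeval ζ f := by
    intro r hr
    have hroot : aeval (ζ ^ r) Φ = 0 := by
      have := (hζ.pow_of_coprime r hr).isRoot_cyclotomic (NeZero.pos n)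
      rwa [IsRoot.def, ← map_cyclotomic n (algebraMap ℚ ℂ), eval_map_algebraMap] at this
    rw [← h r hr, ← aeval_map_algebraMap ℚ (ζ ^ r) f, algebraMap_int_eq,
      ← modByMonic_add_div (f.map (Int.castRingHom ℚ)) Φ, map_add, map_mul, hroot]
    simp [hp]
  have hdeg : p.degree < Φ.degree := degree_modByMonic_lt _ hmonic
  -- The degree is below `φ(n)`, but all `φ(n)` primitive roots are zeros; so `p` is constant, with
  -- a rational coefficient.
  have hzero : p.map (algebraMap ℚ ℂ) - C (aeval ζ f) = 0 := by
    refine eq_zero_of_degree_lt_of_eval_finset_eq_zero (primitiveRoots n ℂ) ?_ ?_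
    · rw [hζ.card_primitiveRoots]
      have hΦd : Φ.degree = (n.totient : WithBot ℕ) := degree_cyclotomic n ℚ
      have hpos : (0 : WithBot ℕ) < (n.totient : WithBot ℕ) := by
        exact_mod_cast Nat.totient_pos.mpr (NeZero.pos n)
      refine (degree_sub_le _ _).trans_lt (max_lt ?_ (degree_C_le.trans_lt hpos))
      rw [degree_map]
      exact hΦd ▸ hdeg
    · intro z hz
      obtain ⟨r, -, hr, rfl⟩ := (hζ.isPrimitiveRoot_iff).mp
        (isPrimitiveRoot_of_mem_primitiveRoots hz)
      simp [eval_map_algebraMap, hval r hr]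
  have h0 := congrArg (fun q => coeff q 0) hzero
  simp only [coeff_sub, coeff_map, coeff_C_zero, coeff_zero] at h0
  exact ⟨_, sub_eq_zero.mp h0⟩

end Cyclotomic

/-! ### Arithmetic of character values and the product formula. -/

section Characters

open Polynomial Module Representation
open scoped ComplexConjugate

theorem sum_conj_commute {G V : Type*} [Group G] [AddCommGroup V] [Module ℂ V] [Fintype G]
    (ρ : Representation ℂ G V) (b g : G) :
    Commute (∑ h : G, ρ (h * b * h⁻¹)) (ρ g) := by
  rw [commute_iff_eq, Finset.sum_mul, Finset.mul_sum]
  refine Fintype.sum_equiv (Equiv.mulLeft g⁻¹) _ _ fun h => ?_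
  rw [← map_mul, ← map_mul]
  congr 1
  simp only [Equiv.coe_mulLeft]
  group

variable {G : Type u} [Group G] {V : Type u} [AddCommGroup V] [Module ℂ V]
  [FiniteDimensional ℂ V]

theorem exists_polynomial_character_pow [Finite G] (ρ : Representation ℂ G V) (x : G) :
    ∃ (ζ : ℂ) (f : ℤ[X]), IsPrimitiveRoot ζ (orderOf x) ∧
      ∀ k : ℕ, ρ.character (x ^ k) = aeval (ζ ^ k) f := by
  have : NeZero (orderOf x) := ⟨(orderOf_pos x).ne'⟩
  have hζ := Complex.isPrimitiveRoot_exp (orderOf x) (orderOf_pos x).ne'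
  obtain ⟨f, hf⟩ := exists_polynomial_trace_pow hζ (A := ρ x)
    (by rw [← map_pow, pow_orderOf_eq_one, map_one])
  exact ⟨_, f, hζ, fun k => by rw [← hf k, character, map_pow]⟩

theorem isIntegral_character [Finite G] (ρ : Representation ℂ G V) (x : G) :
    IsIntegral ℤ (ρ.character x) := by
  obtain ⟨ζ, f, hζ, hf⟩ := exists_polynomial_character_pow ρ x
  have := hf 1
  rw [pow_one, pow_one] at this
  rw [this]
  exact isIntegral_aeval (hζ.isIntegral (orderOf_pos x)) f

theorem character_inv [Finite G] (ρ : Representation ℂ G V) (x : G) :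
    ρ.character x⁻¹ = conj (ρ.character x) := by
  obtain ⟨ζ, f, hζ, hf⟩ := exists_polynomial_character_pow ρ x
  have h1 := hf 1
  have h2 := hf (orderOf x - 1)
  have hn := orderOf_pos x
  have hx : x ^ (orderOf x - 1) = x⁻¹ := by
    rw [eq_inv_iff_mul_eq_one, ← pow_succ, Nat.sub_add_cancel hn, pow_orderOf_eq_one]
  have hz : ζ ^ (orderOf x - 1) = conj ζ := by
    rw [← Complex.inv_eq_conj (Complex.norm_eq_one_of_pow_eq_one hζ.pow_eq_one hn.ne'),
      ← mul_eq_one_iff_eq_inv₀ (hζ.ne_zero hn.ne'), ← pow_succ, Nat.sub_add_cancel hn,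
      hζ.pow_eq_one]
  rw [pow_one, pow_one] at h1
  rw [hx, hz] at h2
  rw [h1, h2]
  exact aeval_algHom_apply (Complex.conjAe.toAlgHom.restrictScalars ℤ) ζ f

theorem isConjRoot_character_of_mem_cyclicGenerators [Finite G] (ρ : Representation ℂ G V)
    {x y : G} (hy : y ∈ cyclicGenerators x) : IsConjRoot ℚ (ρ.character x) (ρ.character y) := by
  have : NeZero (orderOf x) := ⟨(orderOf_pos x).ne'⟩
  obtain ⟨r, hr, rfl⟩ := exists_coprime_pow_of_mem_cyclicGenerators hy
  obtain ⟨ζ, f, hζ, hf⟩ := exists_polynomial_character_pow ρ x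
  have h1 := hf 1
  rw [pow_one, pow_one] at h1
  rw [h1, hf r]
  exact isConjRoot_aeval_pow_of_coprime hζ f hr

theorem IsInverseSemiRationalGroup.character_add_character_inv_mem_range [Finite G]
    (hG : IsInverseSemiRationalGroup G) (ρ : Representation ℂ G V) (x : G) :
    ρ.character x + ρ.character x⁻¹ ∈ (algebraMap ℚ ℂ).range := by
  have : NeZero (orderOf x) := ⟨(orderOf_pos x).ne'⟩
  obtain ⟨ζ, f, hζ, hf⟩ := exists_polynomial_character_pow ρ x
  -- Composing with `X ^ (orderOf x - 1)` inverts the argument, since `x ^ (orderOf x - 1) = x⁻¹`.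
  have key : ∀ k : ℕ, aeval (ζ ^ k) (f + f.comp (X ^ (orderOf x - 1))) =
      ρ.character (x ^ k) + ρ.character (x ^ k)⁻¹ := by
    intro k
    have hxk : (x ^ k)⁻¹ = x ^ (k * (orderOf x - 1)) := by
      rw [inv_eq_iff_mul_eq_one, ← pow_add, add_comm, ← Nat.mul_succ, Nat.succ_eq_add_one,
        Nat.sub_add_cancel (orderOf_pos x), mul_comm, pow_mul, pow_orderOf_eq_one, one_pow]
    rw [hxk, hf, hf, map_add, aeval_comp, map_pow, aeval_X, ← pow_mul]
  have h1 := key 1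
  rw [pow_one, pow_one] at h1
  rw [← h1]
  refine aeval_mem_range_algebraMap_of_forall_coprime hζ _ fun r hr => ?_
  rw [key, h1]
  rcases hG x (pow_mem_cyclicGenerators x hr) with h | h
  · obtain ⟨g, hg⟩ := isConj_iff.mp (show IsConj x (x ^ r) from h)
    rw [← hg, conj_inv, char_conj, char_conj]
  · obtain ⟨g, hg⟩ := isConj_iff.mp (show IsConj x⁻¹ (x ^ r) from h)
    rw [← hg, conj_inv, char_conj, char_conj, inv_inv, add_comm]

/-- **Schur's lemma** for endomorphisms commuting with an irreducible representation. -/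
theorem exists_eq_smul_one_of_commute (ρ : Representation ℂ G V) [ρ.IsIrreducible]
    (T : Module.End ℂ V) (hT : ∀ g, Commute T (ρ g)) : ∃ c : ℂ, T = c • 1 := by
  obtain ⟨c, hc⟩ := (IsIrreducible.algebraMap_intertwiningMap_bijective_of_isAlgClosed
    (ρ := ρ)).surjective ⟨T, fun g => (hT g).eq⟩
  refine ⟨c, ?_⟩
  exact (congrArg IntertwiningMap.toLinearMap hc).symm

theorem finrank_ne_zero_of_isIrreducible (ρ : Representation ℂ G V) [hρ : ρ.IsIrreducible] :
    (finrank ℂ V : ℂ) ≠ 0 := by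
  have : Nontrivial V := IsSimpleModule.nontrivial (MonoidAlgebra ℂ G) ρ.asModule
  exact Nat.cast_ne_zero.mpr (Nat.pos_iff_ne_zero.mp finrank_pos)

/-- The product formula for the values of an irreducible character. -/
theorem card_mul_character_mul_character [Fintype G] (ρ : Representation ℂ G V)
    [ρ.IsIrreducible] (a b : G) :
    (Nat.card G : ℂ) * (ρ.character a * ρ.character b) =
      finrank ℂ V * ∑ h : G, ρ.character (a * (h * b * h⁻¹)) := by
  obtain ⟨c, hc⟩ := exists_eq_smul_one_of_commute ρ _ (sum_conj_commute ρ b)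
  have h1 : (Nat.card G : ℂ) * ρ.character b = c * finrank ℂ V := by
    have := congrArg (LinearMap.trace ℂ V) hc
    rw [map_sum, map_smul, LinearMap.trace_one, smul_eq_mul] at this
    rw [← this]
    have hch : ∀ h : G, LinearMap.trace ℂ V (ρ (h * b * h⁻¹)) = ρ.character b :=
      fun h => char_conj ρ b h
    simp only [hch, Finset.sum_const, Finset.card_univ, nsmul_eq_mul, Nat.card_eq_fintype_card]
  have h2 : ∑ h : G, ρ.character (a * (h * b * h⁻¹)) = c * ρ.character a := by
    have := congrArg (fun T => LinearMap.trace ℂ V (ρ a * T)) hc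
    simpa [Finset.mul_sum, character] using this
  rw [h2]
  linear_combination ρ.character a * h1

end Characters

/-! ### Separation of conjugacy classes, up to inversion, by irreducible characters. -/

section Separation

open Module Representation

/-- The sum of all conjugates of `x`, counted with multiplicity, in the complex group algebra. -/
noncomputable def conjSum {G : Type u} [Group G] [Fintype G] (x : G) : MonoidAlgebra ℂ G :=
  ∑ h : G, MonoidAlgebra.of ℂ G (h * x * h⁻¹)

theorem asAlgebraHom_conjSum {G : Type u} [Group G] [Fintype G] {V : Type u} [AddCommGroup V]
    [Module ℂ V] (ρ : Representation ℂ G V) (x : G) :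
    ρ.asAlgebraHom (conjSum x) = ∑ h : G, ρ (h * x * h⁻¹) := by
  simp only [conjSum, map_sum, asAlgebraHom_of]

theorem trace_asAlgebraHom_conjSum {G : Type u} [Group G] [Fintype G] {V : Type u}
    [AddCommGroup V] [Module ℂ V] [FiniteDimensional ℂ V] (ρ : Representation ℂ G V) (x : G) :
    LinearMap.trace ℂ V (ρ.asAlgebraHom (conjSum x)) = Nat.card G * ρ.character x := by
  have hch : ∀ h : G, LinearMap.trace ℂ V (ρ (h * x * h⁻¹)) = ρ.character x :=
    fun h => char_conj ρ x h
  simp only [asAlgebraHom_conjSum, map_sum, hch, Finset.sum_const, Finset.card_univ,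
    nsmul_eq_mul, Nat.card_eq_fintype_card]

theorem conjSum_coeff {G : Type u} [Group G] [Fintype G] [DecidableEq G] (x y : G) :
    (conjSum x).coeff y = ((Finset.univ.filter fun h : G => h * x * h⁻¹ = y).card : ℂ) := by
  simp [conjSum, MonoidAlgebra.of_apply, Finsupp.single_apply]

theorem smul_eq_zero_of_isSimpleModule {G : Type u} [Group G] [Finite G] (z : MonoidAlgebra ℂ G)
    (h : ∀ (V : Type u) [AddCommGroup V] [Module ℂ V] [FiniteDimensional ℂ V]
      (ρ : Representation ℂ G V), ρ.IsIrreducible → ρ.asAlgebraHom z = 0)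
    (M : Type u) [AddCommGroup M] [Module ℂ M] [Module (MonoidAlgebra ℂ G) M]
    [IsScalarTower ℂ (MonoidAlgebra ℂ G) M]
    [hM : IsSimpleModule (MonoidAlgebra ℂ G) M] (v : M) : z • v = 0 := by
  have hsmul : ∀ (w : MonoidAlgebra ℂ G) (m : M),
      (ofModule' (k := ℂ) (G := G) M).asAlgebraHom w m = w • m := fun w m => by
    have : (ofModule' (k := ℂ) (G := G) M).asAlgebraHom = Algebra.lsmul ℂ ℂ M :=
      (MonoidAlgebra.lift ℂ (Module.End ℂ M) G).apply_symm_apply _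
    rw [this, Algebra.lsmul_coe]
  have : FiniteDimensional ℂ M := Module.Finite.trans (MonoidAlgebra ℂ G) M
  let e : (ofModule' (k := ℂ) (G := G) M).asModule ≃ₗ[MonoidAlgebra ℂ G] M :=
    { (ofModule' (k := ℂ) (G := G) M).asModuleEquiv.toAddEquiv with
      map_smul' := fun w m => (asModuleEquiv_map_smul _ w m).trans (hsmul w _) }
  have h0 := h _ (ofModule' (k := ℂ) (G := G) M)
    ((irreducible_iff_isSimpleModule_asModule _).mpr (IsSimpleModule.congr e))
  rw [← hsmul, h0, LinearMap.zero_apply]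

/-- By Maschke's theorem the group algebra is a sum of simple left ideals; `z` kills each, hence
kills `1`. -/
theorem eq_zero_of_forall_irreducible {G : Type u} [Group G] [Finite G] (z : MonoidAlgebra ℂ G)
    (h : ∀ (V : Type u) [AddCommGroup V] [Module ℂ V] [FiniteDimensional ℂ V]
      (ρ : Representation ℂ G V), ρ.IsIrreducible → ρ.asAlgebraHom z = 0) : z = 0 := by
  have key : ∀ v : MonoidAlgebra ℂ G, z • v = 0 := by
    intro v
    have hv : v ∈ sSup {m : Submodule (MonoidAlgebra ℂ G) (MonoidAlgebra ℂ G) |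
        IsSimpleModule (MonoidAlgebra ℂ G) m} := by
      rw [IsSemisimpleModule.sSup_simples_eq_top]
      trivial
    rw [sSup_eq_iSup'] at hv
    induction hv using Submodule.iSup_induction' with
    | mem m v hv =>
      have hm : IsSimpleModule (MonoidAlgebra ℂ G) m.1 := m.2
      exact congrArg Subtype.val (smul_eq_zero_of_isSimpleModule z h m.1 ⟨v, hv⟩)
    | zero => exact smul_zero z
    | add v w _ _ hv hw => rw [smul_add, hv, hw, add_zero]
  simpa using key 1

/-- Irreducible characters separate the sets `C ∪ C⁻¹`, `C` a conjugacy class. -/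
theorem isConj_or_isConj_inv_of_character_add_character_inv {G : Type u} [Group G] [Finite G]
    {x y : G} (h : ∀ (V : Type u) [AddCommGroup V] [Module ℂ V] [FiniteDimensional ℂ V]
      (ρ : Representation ℂ G V), ρ.IsIrreducible →
      ρ.character y + ρ.character y⁻¹ = ρ.character x + ρ.character x⁻¹) :
    IsConj x y ∨ IsConj x⁻¹ y := by
  classical
  have := Fintype.ofFinite G
  -- This element acts by a scalar on each irreducible representation, and its trace there vanishes.
  have hz : conjSum x + conjSum x⁻¹ - (conjSum y + conjSum y⁻¹) = 0 := by
    refine eq_zero_of_forall_irreducible _ fun V _ _ _ ρ hρ => ?_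
    have hcomm : ∀ g, Commute
        (ρ.asAlgebraHom (conjSum x + conjSum x⁻¹ - (conjSum y + conjSum y⁻¹))) (ρ g) := by
      intro g
      simp only [map_sub, map_add, asAlgebraHom_conjSum]
      exact ((sum_conj_commute ρ _ g).add_left (sum_conj_commute ρ _ g)).sub_left
        ((sum_conj_commute ρ _ g).add_left (sum_conj_commute ρ _ g))
    obtain ⟨c, hc⟩ := exists_eq_smul_one_of_commute ρ _ hcomm
    have htr := congrArg (LinearMap.trace ℂ V) hc
    simp only [map_sub, map_add, trace_asAlgebraHom_conjSum, map_smul, LinearMap.trace_one,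
      smul_eq_mul] at htr
    have h0 : c * finrank ℂ V = 0 := by
      rw [← htr]
      linear_combination -(Nat.card G : ℂ) * h V ρ hρ
    rw [hc, (mul_eq_zero.mp h0).resolve_right (finrank_ne_zero_of_isIrreducible ρ), zero_smul]
  -- The coefficient of `y` is positive on the `y` side, so `y` occurs among the conjugates of `x`
  -- or `x⁻¹`.
  have hcoeff := congrArg (fun w => w.coeff y) (sub_eq_zero.mp hz)
  simp only [MonoidAlgebra.coeff_add, Finsupp.add_apply, conjSum_coeff] at hcoeff
  norm_cast at hcoeff
  have hpos : 0 < (Finset.univ.filter fun h : G => h * y * h⁻¹ = y).card :=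
    Finset.card_pos.mpr ⟨1, by simp⟩
  rcases Nat.eq_zero_or_pos (Finset.univ.filter fun h : G => h * x * h⁻¹ = y).card with h0 | h0
  · right
    have h1 : 0 < (Finset.univ.filter fun h : G => h * x⁻¹ * h⁻¹ = y).card := by omega
    obtain ⟨g, hg⟩ := Finset.card_pos.mp h1
    exact isConj_iff.mpr ⟨g, (Finset.mem_filter.mp hg).2⟩
  · left
    obtain ⟨g, hg⟩ := Finset.card_pos.mp h0
    exact isConj_iff.mpr ⟨g, (Finset.mem_filter.mp hg).2⟩

end Separation

/-! ### Quadratic character fields versus inverse semi-rationality. -/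

section CharacterFields

open Polynomial Module Representation
open scoped ComplexConjugate

/-- An irrational `a` generates the non-real quadratic field `K`, so it is not real and its only
conjugates are `a` and `conj a`. -/
theorem add_conj_eq_of_isConjRoot {K : IntermediateField ℚ ℂ} (hK : finrank ℚ K = 2)
    {z : ℂ} (hz : z ∈ K) (hz' : conj z ≠ z) {a b : ℂ} (ha : a ∈ K) (hab : IsConjRoot ℚ a b) :
    b + conj b = a + conj a := by
  have : FiniteDimensional ℚ K := FiniteDimensional.of_finrank_pos (by omega)
  have hint : IsIntegral ℚ a := (IsIntegral.of_finite ℚ (⟨a, ha⟩ : K)).map K.val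
  by_cases hrat : a ∈ (algebraMap ℚ ℂ).range
  · obtain ⟨q, rfl⟩ := hrat
    rw [hab.eq_algebraMap]
  have hle : IntermediateField.adjoin ℚ {a} ≤ K :=
    IntermediateField.adjoin_le_iff.mpr (Set.singleton_subset_iff.mpr ha)
  have hne : finrank ℚ (IntermediateField.adjoin ℚ {a}) ≠ 1 := by
    rw [Ne, IntermediateField.finrank_eq_one_iff, IntermediateField.adjoin_simple_eq_bot_iff,
      IntermediateField.mem_bot]
    exact hrat
  have hdeg : finrank ℚ (IntermediateField.adjoin ℚ {a}) = 2 := by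
    have h1 := IntermediateField.finrank_le_of_le_right hle
    have : FiniteDimensional ℚ (IntermediateField.adjoin ℚ {a}) :=
      IntermediateField.adjoin.finiteDimensional hint
    have h2 : 0 < finrank ℚ (IntermediateField.adjoin ℚ {a}) := finrank_pos
    omega
  have hKa : IntermediateField.adjoin ℚ {a} = K :=
    IntermediateField.eq_of_le_of_finrank_eq hle (by rw [hdeg, hK])
  have hareal : conj a ≠ a := by
    intro hreal
    refine hz' ?_
    have hsub : K ≤ (Complex.ofRealAm.restrictScalars ℚ).fieldRange := by
      rw [← hKa, IntermediateField.adjoin_le_iff, Set.singleton_subset_iff]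
      obtain ⟨r, hr⟩ := Complex.conj_eq_iff_real.mp hreal
      exact ⟨r, hr.symm⟩
    obtain ⟨r, hr⟩ := hsub hz
    exact Complex.conj_eq_iff_real.mpr ⟨r, hr.symm⟩
  have hmdeg : (minpoly ℚ a).natDegree = 2 := by
    rw [← IntermediateField.adjoin.finrank hint, hdeg]
  have hconj : aeval (conj a) (minpoly ℚ a) = 0 := by
    have := aeval_algHom_apply (Complex.conjAe.toAlgHom.restrictScalars ℚ) a (minpoly ℚ a)
    rw [minpoly.aeval, map_zero] at this
    exact this
  have hcases : b = a ∨ b = conj a := by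
    by_contra! hcon
    refine minpoly.ne_zero hint ?_
    refine (map_eq_zero_iff (mapRingHom (algebraMap ℚ ℂ))
      (map_injective _ (algebraMap ℚ ℂ).injective)).mp ?_
    refine eq_zero_of_natDegree_lt_card_of_eval_eq_zero' _ {b, a, conj a} ?_ ?_
    · intro w hw
      rw [coe_mapRingHom, eval_map_algebraMap]
      simp only [Finset.mem_insert, Finset.mem_singleton] at hw
      rcases hw with rfl | rfl | rfl
      · exact hab.aeval_eq_zero
      · exact minpoly.aeval ℚ _
      · exact hconj
    · rw [coe_mapRingHom, natDegree_map, hmdeg, Finset.card_eq_three.mpr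
        ⟨b, a, conj a, hcon.1, hcon.2, hareal.symm, rfl⟩]
      norm_num
  rcases hcases with rfl | rfl
  · rfl
  · rw [Complex.conj_conj, add_comm]

variable {G : Type u} [Group G]

/-- A quadratic rational group whose real irreducible characters are rational is inverse
semi-rational. -/
theorem IsQuadraticRationalGroup.isInverseSemiRationalGroup [Finite G]
    (hG : IsQuadraticRationalGroup G)
    (hreal : ∀ χ ∈ irreducibleCharacters G, (∀ g, conj (χ g) = χ g) →
      ∀ g, χ g ∈ (algebraMap ℚ ℂ).range) : IsInverseSemiRationalGroup G := by
  intro x y hy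
  refine isConj_or_isConj_inv_of_character_add_character_inv fun V _ _ _ ρ hρ => ?_
  have hχ : ρ.character ∈ irreducibleCharacters G :=
    ⟨V, inferInstance, inferInstance, inferInstance, ρ, hρ, rfl⟩
  have hconj := isConjRoot_character_of_mem_cyclicGenerators ρ hy
  rw [character_inv, character_inv]
  by_cases hr : ∀ g, conj (ρ.character g) = ρ.character g
  · obtain ⟨q, hq⟩ := hreal _ hχ hr x
    rw [← hq] at hconj ⊢
    rw [hconj.eq_algebraMap]
  · push Not at hr
    obtain ⟨g, hg⟩ := hr
    have hmem : ∀ a, ρ.character a ∈ characterField ρ.character := fun a =>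
      IntermediateField.subset_adjoin ℚ _ ⟨a, rfl⟩
    rcases hG _ hχ with h | h
    · have hg' := hmem g
      rw [h, IntermediateField.mem_bot] at hg'
      obtain ⟨q, hq⟩ := hg'
      exact absurd (by rw [← hq]; simp) hg
    · exact add_conj_eq_of_isConjRoot h (hmem g) hg (hmem x) hconj

/-- Two functions with the product formula of an irreducible character and the same symmetric part
agree up to inversion of the argument. -/
theorem eq_or_eq_comp_inv_of_product_formula [Fintype G] {χ ψ : G → ℂ} {N d : ℂ} (hN : N ≠ 0)
    (hχ : ∀ a b, N * (χ a * χ b) = d * ∑ h : G, χ (a * (h * b * h⁻¹)))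
    (hψ : ∀ a b, N * (ψ a * ψ b) = d * ∑ h : G, ψ (a * (h * b * h⁻¹)))
    (hχc : ∀ a b, χ (a * b) = χ (b * a)) (hψc : ∀ a b, ψ (a * b) = ψ (b * a))
    (hs : ∀ g, ψ g + ψ g⁻¹ = χ g + χ g⁻¹) : ψ = χ ∨ ψ = fun g => χ g⁻¹ := by
  have hsym : ∀ f : G → ℂ, (∀ a b, N * (f a * f b) = d * ∑ h : G, f (a * (h * b * h⁻¹))) →
      (∀ a b, f (a * b) = f (b * a)) → ∀ g k,
      N * (f g * f k⁻¹ + f k * f g⁻¹) =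
        d * ∑ h : G, (f (g * (h * k⁻¹ * h⁻¹)) + f (g * (h * k⁻¹ * h⁻¹))⁻¹) := by
    intro f hf hfc g k
    have h2 : ∑ h : G, f (k * (h * g⁻¹ * h⁻¹)) = ∑ h : G, f (g * (h * k⁻¹ * h⁻¹))⁻¹ := by
      refine Fintype.sum_equiv (Equiv.inv G) _ _ fun h => ?_
      rw [show k * (h * g⁻¹ * h⁻¹) = (k * h * g⁻¹) * h⁻¹ by group, hfc]
      congr 1
      simp only [Equiv.inv_apply]
      group
    rw [mul_add, hf, hf, h2, Finset.sum_add_distrib, mul_add]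
  have hS : ∀ g k, ψ g * ψ k⁻¹ + ψ k * ψ g⁻¹ = χ g * χ k⁻¹ + χ k * χ g⁻¹ := by
    intro g k
    refine mul_left_cancel₀ hN ?_
    rw [hsym ψ hψ hψc, hsym χ hχ hχc]
    simp only [hs]
  -- Subtracting `hS g k` from `hS g k⁻¹` isolates the antisymmetric parts, which are thus
  -- determined up to one global sign.
  have hA : ∀ g k, (ψ g - ψ g⁻¹) * (ψ k - ψ k⁻¹) = (χ g - χ g⁻¹) * (χ k - χ k⁻¹) := by
    intro g k
    have h1 := hS g k
    have h2 := hS g k⁻¹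
    rw [inv_inv] at h2
    linear_combination h2 - h1
  by_cases h0 : ∀ k, χ k - χ k⁻¹ = 0
  · left
    funext g
    have h1 := hA g g
    rw [h0 g, mul_zero, mul_self_eq_zero] at h1
    linear_combination (1 / 2) * hs g + (1 / 2) * h1 - (1 / 2) * h0 g
  · push Not at h0
    obtain ⟨k, hk⟩ := h0
    rcases mul_self_eq_mul_self_iff.mp (hA k k) with h1 | h1
    · left
      funext g
      have h2 := hA g k
      rw [h1] at h2
      linear_combination (1 / 2) * hs g + (1 / 2) * mul_right_cancel₀ hk h2
    · right
      funext g
      have h2 := hA g k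
      rw [h1, mul_neg, ← neg_mul] at h2
      linear_combination (1 / 2) * hs g - (1 / 2) * mul_right_cancel₀ hk h2

theorem IsInverseSemiRationalGroup.isQuadraticRationalGroup [Finite G]
    (hG : IsInverseSemiRationalGroup G) : IsQuadraticRationalGroup G := by
  rintro _ ⟨V, _, _, _, ρ, hρ, rfl⟩
  have := Fintype.ofFinite G
  set χ := ρ.character with hχ
  set F := characterField χ with hF
  have hmem : ∀ g, χ g ∈ F := fun g => IntermediateField.subset_adjoin ℚ _ ⟨g, rfl⟩
  have hfin : FiniteDimensional ℚ F := by
    refine IntermediateField.finiteDimensional_adjoin ?_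
    rintro _ ⟨g, rfl⟩
    exact (isIntegral_character ρ g).tower_top
  have hprod := card_mul_character_mul_character ρ
  have hN : (Nat.card G : ℂ) ≠ 0 := Nat.cast_ne_zero.mpr Nat.card_pos.ne'
  have hcases : ∀ φ : F →ₐ[ℚ] ℂ, (fun g => φ ⟨χ g, hmem g⟩) = χ ∨
      (fun g => φ ⟨χ g, hmem g⟩) = fun g => χ g⁻¹ := by
    intro φ
    refine eq_or_eq_comp_inv_of_product_formula hN hprod (fun a b => ?_)
      (fun a b => char_mul_comm ρ b a) (fun a b => ?_) (fun g => ?_)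
    · have h : (Nat.card G : F) * (⟨χ a, hmem a⟩ * ⟨χ b, hmem b⟩) =
          (finrank ℂ V : F) * ∑ h : G, ⟨χ (a * (h * b * h⁻¹)), hmem _⟩ := by
        apply Subtype.ext
        push_cast
        exact hprod a b
      simpa only [map_mul, map_sum, map_natCast] using congrArg φ h
    · congr 2
      exact char_mul_comm ρ b a
    · obtain ⟨q, hq⟩ := hG.character_add_character_inv_mem_range ρ g
      have h : (⟨χ g, hmem g⟩ : F) + ⟨χ g⁻¹, hmem g⁻¹⟩ = algebraMap ℚ F q :=
        Subtype.ext hq.symm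
      rw [← map_add, h, AlgHom.commutes]
      exact hq
  have hinj : Function.Injective (fun (φ : F →ₐ[ℚ] ℂ) (g : G) => φ ⟨χ g, hmem g⟩) := by
    intro φ₁ φ₂ h
    refine IntermediateField.algHom_ext_of_eq_adjoin ℚ (rfl : F = _) ?_
    rintro _ ⟨g, rfl⟩
    exact congrFun h g
  -- In characteristic zero the number of embeddings is the degree.
  have hcard : Nat.card (F →ₐ[ℚ] ℂ) ≤ 2 := by
    rw [← Nat.card_range_of_injective hinj, Nat.card_coe_set_eq]
    refine (Set.ncard_le_ncard (t := {χ, fun g => χ g⁻¹}) ?_ (Set.toFinite _)).trans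
      ((Set.ncard_insert_le _ _).trans (by rw [Set.ncard_singleton]))
    rintro _ ⟨φ, rfl⟩
    exact hcases φ
  rw [Nat.card_eq_fintype_card, AlgHom.card] at hcard
  have hpos : 0 < finrank ℚ F := finrank_pos
  rw [← IntermediateField.finrank_eq_one_iff]
  omega

end CharacterFields

/-! ### Rationality of real irreducible characters. -/

section RealCharacters

open Polynomial Module Representation
open scoped ComplexConjugate commutatorElement

variable {G : Type u} [Group G]

theorem real_character_rational_of_commutator_central [Finite G]
    (hG : ∀ a b c : G, Commute ⁅a, b⁆ c) {χ : G → ℂ} (hχ : χ ∈ irreducibleCharacters G)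
    (hreal : ∀ g, conj (χ g) = χ g) (g : G) : χ g ∈ (algebraMap ℚ ℂ).range := by
  obtain ⟨V, _, _, _, ρ, hρ, rfl⟩ := hχ
  have hd := finrank_ne_zero_of_isIrreducible ρ
  have htr : ∀ c : ℂ, LinearMap.trace ℂ V (c • 1) = c * finrank ℂ V := fun c => by
    rw [map_smul, LinearMap.trace_one, smul_eq_mul]
  -- If `g` is central modulo the kernel, `ρ g` is a real root of unity, so `±1`. Otherwise some
  -- commutator acts by a scalar `c ≠ 1`, and `χ g = c * χ g` forces `χ g = 0`.
  by_cases hcomm : ∀ h : G, ρ ⁅h, g⁆ = 1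
  · obtain ⟨c, hc⟩ := exists_eq_smul_one_of_commute ρ (ρ g) fun h => by
      rw [commute_iff_eq, ← map_mul, ← map_mul]
      calc ρ (g * h) = ρ ⁅h, g⁆ * ρ (g * h) := by rw [hcomm, one_mul]
        _ = ρ (h * g) := by rw [← map_mul, commutatorElement_def]; congr 1; group
    have hval : ρ.character g = c * finrank ℂ V := by rw [character, hc, htr]
    have hpow : c ^ orderOf g = 1 := by
      have h1 : (c ^ orderOf g) • (1 : Module.End ℂ V) = (1 : ℂ) • 1 := by
        have h0 := congrArg ρ (pow_orderOf_eq_one g)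
        rwa [map_pow, map_one, hc, _root_.smul_pow, one_pow, ← one_smul ℂ (1 : Module.End ℂ V),
          smul_smul, mul_one] at h0
      have h2 := congrArg (LinearMap.trace ℂ V) h1
      rw [htr, htr] at h2
      exact mul_right_cancel₀ hd h2
    have hnorm := Complex.norm_eq_one_of_pow_eq_one hpow (orderOf_pos g).ne'
    have hc' : conj c = c := by
      have := hreal g
      rw [hval, map_mul, Complex.conj_natCast] at this
      exact mul_right_cancel₀ hd this
    have hsq : c * c = 1 := by
      nth_rewrite 2 [← hc']
      rw [Complex.mul_conj', hnorm]
      norm_num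
    rw [hval]
    rcases mul_self_eq_one_iff.mp hsq with rfl | rfl
    · exact ⟨finrank ℂ V, by simp⟩
    · exact ⟨-finrank ℂ V, by simp⟩
  · push Not at hcomm
    obtain ⟨h, hh⟩ := hcomm
    obtain ⟨c, hc⟩ := exists_eq_smul_one_of_commute ρ (ρ ⁅h, g⁆) fun k => (hG h g k).map ρ
    have hc1 : c ≠ 1 := by
      rintro rfl
      exact hh (by rw [hc, one_smul])
    have hval : ρ.character g = c * ρ.character g := by
      calc ρ.character g = ρ.character (h * g * h⁻¹) := (char_conj ρ g h).symm
        _ = ρ.character (⁅h, g⁆ * g) := by rw [commutatorElement_def]; congr 1; group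
        _ = c * ρ.character g := by
          rw [character, map_mul, hc, smul_mul_assoc, one_mul, map_smul, smul_eq_mul, character]
    have h0 : (c - 1) * ρ.character g = 0 := by linear_combination -hval
    rw [(mul_eq_zero.mp h0).resolve_left (sub_ne_zero.mpr hc1)]
    exact zero_mem _

/-- Squaring is additive modulo `2`; this supplies the parity argument for the group order. -/
theorem exists_isIntegral_sq_sum {ι : Type*} (s : Finset ι) (f : ι → ℂ)
    (hf : ∀ i, IsIntegral ℤ (f i)) :
    ∃ c : ℂ, IsIntegral ℤ c ∧ (∑ i ∈ s, f i) ^ 2 = ∑ i ∈ s, f i ^ 2 + 2 * c := by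
  classical
  induction s using Finset.induction_on with
  | empty => exact ⟨0, isIntegral_zero, by simp⟩
  | insert a s ha ih =>
    obtain ⟨c, hc, h⟩ := ih
    refine ⟨c + f a * ∑ i ∈ s, f i,
      hc.add ((hf a).mul (IsIntegral.sum f fun i _ => hf i)), ?_⟩
    rw [Finset.sum_insert ha, Finset.sum_insert ha]
    linear_combination h

/-- A real irreducible character whose values sum to zero forces even order. -/
theorem even_card_of_real_character_of_sum_eq_zero [Fintype G] {V : Type u} [AddCommGroup V]
    [Module ℂ V] [FiniteDimensional ℂ V] (ρ : Representation ℂ G V) [ρ.IsIrreducible]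
    (hreal : ∀ g, conj (ρ.character g) = ρ.character g) (hsum : ∑ g, ρ.character g = 0) :
    Even (Nat.card G) := by
  have hN : (Nat.card G : ℂ) ≠ 0 := Nat.cast_ne_zero.mpr Nat.card_pos.ne'
  have : Invertible (Nat.card G : ℂ) := invertibleOfNonzero hN
  have horth := char_orthonormal ρ ρ
  rw [if_pos ⟨Representation.Equiv.refl ρ⟩, inv_mul_eq_one₀ hN] at horth
  simp only [character_inv, hreal] at horth
  obtain ⟨c, hc, h⟩ := exists_isIntegral_sq_sum Finset.univ ρ.character (isIntegral_character ρ)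
  rw [hsum] at h
  simp only [pow_two] at h
  rw [← horth] at h
  -- Orthonormality of a real `χ` reads `∑ χ g ^ 2 = |G|`, so `0 = |G| + 2 * c` with `c` integral
  -- and rational.
  have hq : algebraMap ℚ ℂ (-(Nat.card G : ℚ) / 2) = c := by
    push_cast [eq_ratCast]
    linear_combination (1 / 2) * h
  rw [← hq, isIntegral_algebraMap_iff (algebraMap ℚ ℂ).injective] at hc
  obtain ⟨m, hm⟩ := IsIntegrallyClosed.isIntegral_iff.mp hc
  have h3 : (Nat.card G : ℚ) = ((-2 * m : ℤ) : ℚ) := by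
    rw [eq_intCast] at hm
    push_cast
    linear_combination 2 * hm
  have h4 : (Nat.card G : ℤ) = -2 * m := by exact_mod_cast h3
  rw [← Int.even_coe_nat, h4]
  exact (by decide : Even (-2 : ℤ)).mul_right m

/-- Odd order makes the character sum nonzero, so there are nonzero invariants; by irreducibility
they fill `V`, and the action is trivial. -/
theorem real_character_rational_of_odd_card [Finite G] (hG : Odd (Nat.card G)) {χ : G → ℂ}
    (hχ : χ ∈ irreducibleCharacters G) (hreal : ∀ g, conj (χ g) = χ g) (g : G) :
    χ g ∈ (algebraMap ℚ ℂ).range := by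
  obtain ⟨V, _, _, _, ρ, hρ, rfl⟩ := hχ
  have := Fintype.ofFinite G
  have hN : (Nat.card G : ℂ) ≠ 0 := Nat.cast_ne_zero.mpr Nat.card_pos.ne'
  have : Invertible (Nat.card G : ℂ) := invertibleOfNonzero hN
  have hsum : ∑ g, ρ.character g ≠ 0 := fun h =>
    Nat.not_even_iff_odd.mpr hG (even_card_of_real_character_of_sum_eq_zero ρ hreal h)
  have hinv := card_inv_mul_sum_char_eq_finrank ρ
  let W : Subrepresentation ρ :=
    { toSubmodule := ρ.invariants
      apply_mem_toSubmodule := fun g v hv => by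
        rw [(mem_invariants ρ v).mp hv g]; exact hv }
  have hW : W = ⊤ := by
    refine (eq_bot_or_eq_top W).resolve_left fun h => ?_
    have hbot : ρ.invariants = ⊥ := congrArg Subrepresentation.toSubmodule h
    rw [hbot, finrank_bot, Nat.cast_zero] at hinv
    exact hsum ((mul_eq_zero.mp hinv).resolve_left (inv_ne_zero hN))
  have htop : ρ.invariants = ⊤ := congrArg Subrepresentation.toSubmodule hW
  have hone : ρ g = 1 := by
    ext v
    exact (mem_invariants ρ v).mp (htop ▸ Submodule.mem_top) g
  exact ⟨finrank ℂ V, by rw [character, hone, LinearMap.trace_one]; simp⟩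

end RealCharacters

theorem mainTheorem5 (G : Type u) [Group G] [Finite G]
    (hG : (∃ _ : Group.IsNilpotent G, Group.nilpotencyClass G ≤ 2) ∨ Odd (Nat.card G)) :
    List.TFAE [
      IsInverseSemiRationalGroup G,
      IsUniformlySemiRationalGroup G,
      IsQuadraticSemiRationalGroup G,
      IsQuadraticRationalGroup G,
      IsSemiRationalGroup G] := by
  have hconj : ∀ x : G, IsConj x x⁻¹ → x ^ 4 = 1 := by
    intro x hx
    rcases hG with ⟨_, h⟩ | h
    · exact pow_four_eq_one_of_isConj_inv_of_commutator_central
        (commute_commutator_of_nilpotencyClass_le_two h) hx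
    · rw [eq_one_of_isConj_inv_of_odd_card h hx, one_pow]
  tfae_have 1 → 2 := IsInverseSemiRationalGroup.isUniformlySemiRationalGroup
  tfae_have 2 → 5 := IsUniformlySemiRationalGroup.isSemiRationalGroup
  tfae_have 5 → 1 := fun h => h.isInverseSemiRationalGroup hconj
  tfae_have 1 → 4 := IsInverseSemiRationalGroup.isQuadraticRationalGroup
  tfae_have 4 → 1 := by
    intro h
    refine h.isInverseSemiRationalGroup fun χ hχ hreal g => ?_
    rcases hG with ⟨_, hc⟩ | ho
    · exact real_character_rational_of_commutator_central
        (commute_commutator_of_nilpotencyClass_le_two hc) hχ hreal g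
    · exact real_character_rational_of_odd_card ho hχ hreal g
  tfae_have 3 → 5 := fun h => h.1
  tfae_have 1 → 3 := fun h =>
    ⟨h.isUniformlySemiRationalGroup.isSemiRationalGroup, h.isQuadraticRationalGroup⟩
  tfae_finish
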